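/- Let $G$ be a Lie group with Lie algebra $\mathfrak g$, let $p\colon P\to M$ be a (smooth) principal $U(1)$-bundle on which $G$ acts smoothly from the left by principal bundle automorphisms (write $\phi_P$, $\phi_M$ for the actions of $\phi\in G$ on $P$ and $M$), and let $\Xi\in\Omega^1(P,i\mathbb R)$ be a $G$-invariant connection. For $\phi\in G$ and $x\in M$ let $\mathcal C^{\phi}_x(M)$ be the set of piecewise $C^1$ curves $\gamma\colon[0,1]\to M$ with $\gamma(0)=x$ and $\gamma(1)=\phi_M(x)$. For $\gamma\in\mathcal C^\phi_x(M)$ the equivariant holonomy $\mathrm{Hol}^\Xi_\phi(\gamma)\in U(1)$ is characterized by $\overline\gamma^{\,y}(1)=\phi_P(y)\cdot\mathrm{Hol}^\Xi_\phi(\gamma)$ for every $y\in p^{-1}(x)$, where $\overline\gamma^{\,y}$ is the $\Xi$-horizontal lift of $\gamma$ with $\overline\gamma^{\,y}(0)=y$. For $X\in\mathfrak g$ put $X_P(y)=\left.\tfrac{d}{dt}\right|_{t=0}\exp(-tX)_P(y)$, and let the momentum $\mu^\Xi_X\colon M\to\mathbb R$ be given by $\mu^\Xi_X(p(y))=-\tfrac{i}{2\pi}\,\Xi(X_P)(y)$.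 Let $\varepsilon>0$, let $\varphi\colon(t_0-\varepsilon,t_0+\varepsilon)\to G$ be a $C^1$ curve with $\varphi_{t_0}=e$ and $\dot\varphi_{t_0}=X\in\mathfrak g$, let $x\in M$, and put $\sigma_{x,t}(s)=(\varphi_{t_0+s(t-t_0)})_M(x)$ for $s\in[0,1]$. Then for every $t\in(t_0-\varepsilon,t_0+\varepsilon)$ we have $\sigma_{x,t}\in\mathcal C^{\varphi_t}_x(M)$ and the holonomy $\mathrm{Hol}^\Xi_{\varphi_t}(\sigma_{x,t})$ is well defined by the above characterization, and $$\left.\frac{d}{dt}\right|_{t=t_0}\mathrm{Hol}^\Xi_{\varphi_t}(\sigma_{x,t})=2\pi i\,\mu^\Xi_X(x).$$ -/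

import Mathlib

open Set
open scoped Manifold ContDiff

noncomputable section

namespace EquivHol

variable {EG : Type*} [NormedAddCommGroup EG] [NormedSpace ℝ EG] {HG : Type*} [TopologicalSpace HG]
  {IG : ModelWithCorners ℝ EG HG}
  {G : Type*} [TopologicalSpace G] [ChartedSpace HG G] [Group G]
  {EM : Type*} [NormedAddCommGroup EM] [NormedSpace ℝ EM] {HM : Type*} [TopologicalSpace HM]
  {IM : ModelWithCorners ℝ EM HM}
  {M : Type*} [TopologicalSpace M] [ChartedSpace HM M]
  {EP : Type*} [NormedAddCommGroup EP] [NormedSpace ℝ EP] {HP : Type*} [TopologicalSpace HP]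
  {IP : ModelWithCorners ℝ EP HP}
  {P : Type*} [TopologicalSpace P] [ChartedSpace HP P]

variable (IM M IP P) in
/-- A smooth principal `U(1)`-bundle `P → M`: a smooth projection, a smooth fibre-preserving right
action of the circle group, and smooth `U(1)`-equivariant local trivializations. (That `U(1)` acts
freely and transitively on the fibres follows from local triviality.) -/
structure PrincipalU1Bundle where
  /-- the projection `p : P → M` -/
  proj : P → M
  /-- the right action `(y, u) ↦ y · u` of `U(1)` on `P` -/
  ract : P → Circle → P
  ract_one : ∀ y, ract y 1 = y
  ract_mul : ∀ y u v, ract y (u * v) = ract (ract y u) v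
  proj_ract : ∀ y u, proj (ract y u) = proj y
  contMDiff_proj : ContMDiff IP IM ∞ proj
  contMDiff_ract : ContMDiff (IP.prod (𝓡 1)) IP ∞ (fun q : P × Circle => ract q.1 q.2)
  locally_trivial : ∀ x : M, ∃ U : Set M, IsOpen U ∧ x ∈ U ∧
    ∃ Ψ : OpenPartialHomeomorph P (M × Circle),
      Ψ.source = proj ⁻¹' U ∧ Ψ.target = U ×ˢ (univ : Set Circle) ∧
      ContMDiffOn IP (IM.prod (𝓡 1)) ∞ Ψ Ψ.source ∧
      ContMDiffOn (IM.prod (𝓡 1)) IP ∞ Ψ.symm Ψ.target ∧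
      (∀ y ∈ Ψ.source, (Ψ y).1 = proj y) ∧
      (∀ y ∈ Ψ.source, ∀ u : Circle, Ψ (ract y u) = ((Ψ y).1, (Ψ y).2 * u))

theorem PrincipalU1Bundle.proj_surjective (B : PrincipalU1Bundle IM M IP P) :
    Function.Surjective B.proj := by
  intro x
  obtain ⟨U, -, hx, Ψ, -, ht, -, -, h1, -⟩ := B.locally_trivial x
  have hm : (x, (1 : Circle)) ∈ Ψ.target := by rw [ht]; exact ⟨hx, mem_univ _⟩
  exact ⟨Ψ.symm (x, 1), by rw [← h1 _ (Ψ.map_target hm), Ψ.right_inv hm]⟩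

/-- `U(1)` acts transitively on the fibres. -/
theorem PrincipalU1Bundle.exists_ract_eq (B : PrincipalU1Bundle IM M IP P) {y z : P}
    (h : B.proj y = B.proj z) : ∃ u : Circle, z = B.ract y u := by
  obtain ⟨U, -, hx, Ψ, hs, -, -, -, h1, h2⟩ := B.locally_trivial (B.proj y)
  have hy : y ∈ Ψ.source := by rw [hs]; exact hx
  have hz : z ∈ Ψ.source := by rw [hs, mem_preimage, ← h]; exact hx
  refine ⟨(Ψ y).2⁻¹ * (Ψ z).2, Ψ.injOn hz ?_ ?_⟩
  · rw [hs, mem_preimage, B.proj_ract]; exact hx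
  · rw [h2 y hy, mul_inv_cancel_left, h1 y hy, h, ← h1 z hz]

/-- `G` acts (on the left) on `P → M` by principal bundle automorphisms. -/
structure IsEquivariant (G : Type*) [Group G] [MulAction G M] [MulAction G P]
    (B : PrincipalU1Bundle IM M IP P) : Prop where
  proj_smul : ∀ (g : G) (y : P), B.proj (g • y) = g • B.proj y
  smul_ract : ∀ (g : G) (y : P) (u : Circle), g • B.ract y u = B.ract (g • y) u

/-- A connection on a principal `U(1)`-bundle: a smooth `1`-form `Ξ` on `P` with values in
`iℝ ⊆ ℂ`, invariant under the right action of `U(1)`, with `Ξ(ξ_P) = i` where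
`ξ_P(y) = d/dθ|₀ (y · exp(iθ))`. Smoothness of a `1`-form is smoothness of the associated function
`(y, v) ↦ Ξ_y(v)` on the tangent bundle. -/
structure Connection [IsManifold IP ∞ P] (B : PrincipalU1Bundle IM M IP P) where
  form : ∀ y : P, TangentSpace IP y →L[ℝ] ℂ
  re_form : ∀ y v, (form y v).re = 0
  contMDiff_form : ContMDiff IP.tangent 𝓘(ℝ, ℂ) ∞
    (fun v : TangentBundle IP P => form v.proj v.snd)
  form_vertical : ∀ y : P,
    form (B.ract y (Circle.exp 0))
      (mfderiv 𝓘(ℝ, ℝ) IP (fun θ : ℝ => B.ract y (Circle.exp θ)) 0 (1 : ℝ)) = Complex.I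
  form_ract : ∀ (u : Circle) (y : P) (v : TangentSpace IP y),
    form (B.ract y u) (mfderiv IP IP (fun z => B.ract z u) y v) = form y v

/-- The connection is `G`-invariant: `(φ_P)^* Ξ = Ξ` for all `φ ∈ G`. -/
def Connection.IsInvariant [IsManifold IP ∞ P] {B : PrincipalU1Bundle IM M IP P}
    (Ξ : Connection B) (G : Type*) [Group G] [MulAction G P] : Prop :=
  ∀ (g : G) (y : P) (v : TangentSpace IP y),
    Ξ.form (g • y) (mfderiv IP IP (fun z : P => g • z) y v) = Ξ.form y v

/-- The fundamental vector field `X_P` of `X ∈ 𝔤`, with the sign convention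
`X_P(y) = d/dt|₀ exp(-tX) y`; that is, the image of `-X` under the differential at the identity
of the orbit map `g ↦ g y`. See `hasMFDerivAt_curve_smul`. -/
def fundamentalField [MulAction G P] (X : GroupLieAlgebra IG G) (y : P) :
    TangentSpace IP ((1 : G) • y) :=
  mfderiv IG IP (fun g : G => g • y) 1 (-X)

theorem contMDiff_orbit [MulAction G P] [ContMDiffSMul IG IP ∞ G P] (y : P) :
    ContMDiff IG IP ∞ (fun g : G => g • y) :=
  (contMDiff_smul (I := IG) (I' := IP) (n := ∞) (G := G) (M := P)).comp
    (contMDiff_id.prodMk contMDiff_const)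

/-- `X_P(y)` is the velocity at `0` of `t ↦ c(-t) y` for every curve `c` in `G` with `c(0) = 1`
and `c'(0) = X`, in particular for `c(t) = exp(tX)`. -/
theorem mfderiv_curve_smul [MulAction G P] [ContMDiffSMul IG IP ∞ G P]
    (X : GroupLieAlgebra IG G) (y : P) (c : ℝ → G) (hc : MDifferentiableAt 𝓘(ℝ, ℝ) IG c 0)
    (hX : (⟨c 0, mfderiv 𝓘(ℝ, ℝ) IG c 0 (1 : ℝ)⟩ : TangentBundle IG G) = ⟨1, X⟩) :
    (⟨c (-0) • y, mfderiv 𝓘(ℝ, ℝ) IP (fun t : ℝ => c (-t) • y) 0 (1 : ℝ)⟩ : TangentBundle IP P) =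
      ⟨(1 : G) • y, fundamentalField X y⟩ := by
  have h0 : c 0 = 1 := congrArg Bundle.TotalSpace.proj hX
  have hc' : MDifferentiableAt 𝓘(ℝ, ℝ) IG c (-0) := by rwa [neg_zero]
  have hn : MDifferentiableAt 𝓘(ℝ, ℝ) 𝓘(ℝ, ℝ) (fun t : ℝ => -t) 0 :=
    (differentiableAt_id.neg).mdifferentiableAt
  have ho := (contMDiff_orbit (IG := IG) (IP := IP) (G := G) y).mdifferentiable (by simp)
  have e1 : mfderiv 𝓘(ℝ, ℝ) IP (fun t : ℝ => c (-t) • y) 0 (1 : ℝ) =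
      mfderiv IG IP (fun g : G => g • y) (c (-0))
        (mfderiv 𝓘(ℝ, ℝ) IG c (-0) (mfderiv 𝓘(ℝ, ℝ) 𝓘(ℝ, ℝ) (fun t : ℝ => -t) 0 (1 : ℝ))) := by
    rw [show (fun t : ℝ => c (-t) • y) = (fun g : G => g • y) ∘ (c ∘ fun t : ℝ => -t) from rfl,
      mfderiv_comp (I' := IG) 0 (ho _) (hc'.comp 0 hn), mfderiv_comp (I' := 𝓘(ℝ, ℝ)) 0 hc' hn]
    rfl
  have e2 : mfderiv 𝓘(ℝ, ℝ) 𝓘(ℝ, ℝ) (fun t : ℝ => -t) 0 (1 : ℝ) = (-1 : ℝ) := by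
    have h : fderiv ℝ (fun t : ℝ => -t) 0 (1 : ℝ) = -1 := by simp
    rw [mfderiv_eq_fderiv]
    exact h
  have e3 : mfderiv 𝓘(ℝ, ℝ) IP (fun t : ℝ => c (-t) • y) 0 (1 : ℝ) =
      mfderiv IG IP (fun g : G => g • y) (c (-0)) (-(mfderiv 𝓘(ℝ, ℝ) IG c (-0) (1 : ℝ))) := by
    rw [e1, e2]
    congr 1
    exact (mfderiv 𝓘(ℝ, ℝ) IG c (-0)).map_neg (1 : ℝ)
  rw [e3]
  have gen : ∀ v : TangentBundle IG G, v = ⟨1, X⟩ →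
      (⟨v.proj • y, mfderiv IG IP (fun g : G => g • y) v.proj (-v.snd)⟩ : TangentBundle IP P) =
        ⟨(1 : G) • y, fundamentalField X y⟩ := by
    rintro v rfl
    rfl
  refine gen ⟨c (-0), mfderiv 𝓘(ℝ, ℝ) IG c (-0) (1 : ℝ)⟩ ?_
  rw [← hX]
  have : ∀ r : ℝ, r = 0 → (⟨c r, mfderiv 𝓘(ℝ, ℝ) IG c r (1 : ℝ)⟩ : TangentBundle IG G) =
      ⟨c 0, mfderiv 𝓘(ℝ, ℝ) IG c 0 (1 : ℝ)⟩ := by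
    rintro r rfl
    rfl
  exact this _ neg_zero

/-- The momentum `μ_X = -(i/2π) Ξ(X_P)`, a real function on `M`; the (real) value is computed at
any point of the fibre over `x`, see `Connection.momentum_proj`. -/
def Connection.momentum [IsManifold IP ∞ P] {B : PrincipalU1Bundle IM M IP P} (Ξ : Connection B)
    [MulAction G P] (X : GroupLieAlgebra IG G) (x : M) : ℝ :=
  let y : P := (B.proj_surjective x).choose
  (-(Complex.I / (2 * Real.pi)) * Ξ.form ((1 : G) • y) (fundamentalField X y)).re

theorem Connection.momentum_proj [IsManifold IP ∞ P] {B : PrincipalU1Bundle IM M IP P}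
    (Ξ : Connection B) [MulAction G M] [MulAction G P] [ContMDiffSMul IG IP ∞ G P]
    (hB : IsEquivariant G B) (X : GroupLieAlgebra IG G) (y : P) :
    (Ξ.momentum X (B.proj y) : ℂ) =
      -(Complex.I / (2 * Real.pi)) * Ξ.form ((1 : G) • y) (fundamentalField X y) := by
  have key : ∀ u : Circle, Ξ.form ((1 : G) • B.ract y u) (fundamentalField X (B.ract y u)) =
      Ξ.form ((1 : G) • y) (fundamentalField X y) := by
    intro u
    have hr : ContMDiff IP IP ∞ (fun z => B.ract z u) :=
      B.contMDiff_ract.comp (contMDiff_id.prodMk contMDiff_const)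
    have gen : ∀ f : G → P, f = (fun z => B.ract z u) ∘ (fun g : G => g • y) →
        Ξ.form (f 1) (mfderiv IG IP f 1 (-X)) = Ξ.form ((1 : G) • y) (fundamentalField X y) := by
      rintro f rfl
      rw [mfderiv_comp (I' := IP) 1 (hr.mdifferentiable (by simp) _)
        ((contMDiff_orbit (IG := IG) (IP := IP) (G := G) y).mdifferentiable (by simp) _)]
      exact Ξ.form_ract u _ _
    exact gen (fun g : G => g • B.ract y u) (funext fun g => hB.smul_ract g y u)
  obtain ⟨u, hu⟩ := B.exists_ract_eq (B.proj_surjective (B.proj y)).choose_spec.symm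
  have hre := Ξ.re_form ((1 : G) • y) (fundamentalField X y)
  have hk : ∀ z, z = B.ract y u → Ξ.form ((1 : G) • z) (fundamentalField X z) =
      Ξ.form ((1 : G) • y) (fundamentalField X y) := by
    rintro z rfl
    exact key u
  have hm : Ξ.momentum X (B.proj y) =
      (-(Complex.I / (2 * Real.pi)) * Ξ.form ((1 : G) • y) (fundamentalField X y)).re := by
    rw [← hk _ hu]
    rfl
  rw [hm]
  generalize Ξ.form ((1 : G) • y) (fundamentalField X y) = w at hre ⊢
  apply Complex.ext
  · simp
  · have : (Complex.I / (2 * Real.pi) : ℂ) = ((1 / (2 * Real.pi) : ℝ) : ℂ) * Complex.I := by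
      push_cast; ring
    rw [this]
    simp [hre]

variable (IM) in
/-- `γ : [0,1] → M` is piecewise `C¹` (only the values of `γ` on `[0,1]` matter): `[0,1]` is
divided into finitely many closed intervals on each of which `γ` is `C¹` up to the endpoints. -/
def PiecewiseC1 (γ : ℝ → M) : Prop :=
  ∃ (n : ℕ) (a : ℕ → ℝ), a 0 = 0 ∧ a n = 1 ∧ Monotone a ∧
    ∀ i < n, ContMDiffOn 𝓘(ℝ, ℝ) IM 1 γ (Icc (a i) (a (i + 1)))

variable (IM) in
/-- The set of piecewise `C¹` curves `γ : [0,1] → M` with `γ(0) = x` and `γ(1) = φ_M(x)`. -/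
def pathSpace [MulAction G M] (φ : G) (x : M) : Set (ℝ → M) :=
  {γ | PiecewiseC1 IM γ ∧ γ 0 = x ∧ γ 1 = φ • x}

/-- `c : [0,1] → P` is a `Ξ`-horizontal lift of `γ : [0,1] → M` with `c(0) = y`. -/
structure Connection.IsHorizontalLift [IsManifold IP ∞ P] {B : PrincipalU1Bundle IM M IP P}
    (Ξ : Connection B) (γ : ℝ → M) (y : P) (c : ℝ → P) : Prop where
  piecewiseC1 : PiecewiseC1 IP c
  proj_eq : ∀ s ∈ Icc (0 : ℝ) 1, B.proj (c s) = γ s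
  start : c 0 = y
  horizontal : ∀ s ∈ Ioo (0 : ℝ) 1, MDifferentiableAt 𝓘(ℝ, ℝ) IP c s →
    Ξ.form (c s) (mfderiv 𝓘(ℝ, ℝ) IP c s (1 : ℝ)) = 0

/-- The characterization of the equivariant holonomy: for all `y` over `γ(0)` the curve `γ` has a
horizontal lift from `y`, and every such lift `c` satisfies `c(1) = φ_P(y) · u`. -/
def Connection.IsHolonomy [IsManifold IP ∞ P] {B : PrincipalU1Bundle IM M IP P} (Ξ : Connection B)
    [MulAction G P] (φ : G) (γ : ℝ → M) (u : Circle) : Prop :=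
  ∀ y : P, B.proj y = γ 0 →
    (∃ c, Ξ.IsHorizontalLift γ y c) ∧ ∀ c, Ξ.IsHorizontalLift γ y c → c 1 = B.ract (φ • y) u

open Classical in
/-- The equivariant holonomy `Hol_φ(γ) ∈ U(1)` of `γ` with `γ(1) = φ_M(γ(0))`: the element
characterized by `IsHolonomy` (and `1` if there is none). -/
def Connection.hol [IsManifold IP ∞ P] {B : PrincipalU1Bundle IM M IP P} (Ξ : Connection B)
    [MulAction G P] (φ : G) (γ : ℝ → M) : Circle :=
  if h : ∃ u, Ξ.IsHolonomy φ γ u then h.choose else 1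

/-- The path `s ↦ (φ_{t₀ + s(t - t₀)})_M(x)` along the orbit of `x`. -/
def orbitPath [MulAction G M] (φ : ℝ → G) (t₀ : ℝ) (x : M) (t s : ℝ) : M :=
  φ (t₀ + s * (t - t₀)) • x

end EquivHol

end

noncomputable section

open Set Filter Topology
open scoped Manifold ContDiff

namespace EquivHol

variable {EG : Type*} [NormedAddCommGroup EG] [NormedSpace ℝ EG] {HG : Type*} [TopologicalSpace HG]
  {IG : ModelWithCorners ℝ EG HG}
  {G : Type*} [TopologicalSpace G] [ChartedSpace HG G] [Group G]
  {EM : Type*} [NormedAddCommGroup EM] [NormedSpace ℝ EM] {HM : Type*} [TopologicalSpace HM]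
  {IM : ModelWithCorners ℝ EM HM}
  {M : Type*} [TopologicalSpace M] [ChartedSpace HM M]
  {EP : Type*} [NormedAddCommGroup EP] [NormedSpace ℝ EP] {HP : Type*} [TopologicalSpace HP]
  {IP : ModelWithCorners ℝ EP HP}
  {P : Type*} [TopologicalSpace P] [ChartedSpace HP P]

/-! Fix `y` over `x`. The curve `D(t) = φ_t y` lies over `t ↦ φ_t x`. Rotating a curve changes the
value of the connection on its velocity by `Ξ((D · exp(iθ))') = Ξ(D') + iθ'` (`velocity_rotate`),
and `Ξ` is imaginary. Hence with `θ(t₀) = 0` and `θ' = -Im Ξ(D')` the curve `C = D · exp(iθ)` is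
horizontal (`exists_horizontal_rotation`). This single `C` serves every `t`: its affine
reparametrization on `[t₀, t]` lifts `σ_{x,t}`, starts at `y` and ends at `φ_t y · exp(iθ(t))`. So
the holonomy is exactly `exp(iθ(t))`, and its derivative at `t₀` is `iθ'(t₀) = -Ξ(D'(t₀)) =
Ξ(X_P)(y) = 2πi μ_X(x)`; the sign is the one in `X_P` (`momentum_eq_velocity`). The holonomy is well
defined because lifts with the same start have the same endpoint (`endpoint_unique`), and because
`U(1)` is abelian, so the choice of `y` does not matter (`isHolonomy`). -/

/-! ### Regularity of the action and of the ratio of two curves in the same fibres. -/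

/-- `U(1)` acts freely on the total space. -/
theorem PrincipalU1Bundle.ract_injective (B : PrincipalU1Bundle IM M IP P) (y : P) :
    Function.Injective (B.ract y) := by
  intro u v huv
  obtain ⟨U, -, hx, Ψ, hs, -, -, -, -, h2⟩ := B.locally_trivial (B.proj y)
  have hy : y ∈ Ψ.source := by rw [hs]; exact hx
  have h := congrArg (fun z => (Ψ z).2) huv
  simp only [h2 y hy] at h
  exact mul_left_cancel h

theorem PrincipalU1Bundle.contMDiff_rotate (B : PrincipalU1Bundle IM M IP P) :
    ContMDiff (IP.prod 𝓘(ℝ, ℝ)) IP ∞ (fun q : P × ℝ => B.ract q.1 (Circle.exp q.2)) :=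
  B.contMDiff_ract.comp (contMDiff_fst.prodMk (contMDiff_circleExp.comp contMDiff_snd))

theorem PrincipalU1Bundle.contMDiff_ract_right (B : PrincipalU1Bundle IM M IP P) (u : Circle) :
    ContMDiff IP IP ∞ (fun z => B.ract z u) :=
  B.contMDiff_ract.comp (contMDiff_id.prodMk contMDiff_const)

theorem PrincipalU1Bundle.contMDiff_rotate_right (B : PrincipalU1Bundle IM M IP P) (y : P) :
    ContMDiff 𝓘(ℝ, ℝ) IP ∞ (fun θ : ℝ => B.ract y (Circle.exp θ)) :=
  B.contMDiff_rotate.comp (contMDiff_const.prodMk contMDiff_id)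

/-- For curves in the same fibres, the ratio is differentiable wherever both curves are. -/
theorem PrincipalU1Bundle.differentiableAt_ratio (B : PrincipalU1Bundle IM M IP P) {c d : ℝ → P}
    {u : ℝ → Circle} {s : ℝ} (hc : MDifferentiableAt 𝓘(ℝ, ℝ) IP c s)
    (hd : MDifferentiableAt 𝓘(ℝ, ℝ) IP d s) (hu : ∀ᶠ r in 𝓝 s, d r = B.ract (c r) (u r)) :
    DifferentiableAt ℝ (fun r => (u r : ℂ)) s := by
  obtain ⟨U, hU, hx, Ψ, hs, -, hΨ, -, h1, h2⟩ := B.locally_trivial (B.proj (c s))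
  have : Fact (Module.finrank ℝ ℂ = 1 + 1) := finrank_real_complex_fact'
  have coe : ContMDiff (𝓡 1) 𝓘(ℝ, ℂ) ∞ (fun z : Circle => (z : ℂ)) :=
    contMDiff_coe_sphere (n := 1) (E := ℂ)
  have key : ∀ e : ℝ → P, MDifferentiableAt 𝓘(ℝ, ℝ) IP e s → e s ∈ Ψ.source →
      DifferentiableAt ℝ (fun r => ((Ψ (e r)).2 : ℂ)) s := by
    intro e he hes
    have hΨe : MDifferentiableAt IP (IM.prod (𝓡 1)) Ψ (e s) :=
      ((hΨ _ hes).contMDiffAt (Ψ.open_source.mem_nhds hes)).mdifferentiableAt (by simp)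
    have h3 : MDifferentiableAt 𝓘(ℝ, ℝ) (IM.prod (𝓡 1)) (fun r => Ψ (e r)) s := hΨe.comp s he
    have h4 : MDifferentiableAt 𝓘(ℝ, ℝ) 𝓘(ℝ, ℂ) (fun r => ((Ψ (e r)).2 : ℂ)) s :=
      (coe.mdifferentiable (by simp) _).comp s (mdifferentiableAt_snd.comp s h3)
    exact h4.differentiableAt
  have hcs : c s ∈ Ψ.source := by rw [hs]; exact hx
  have hds : d s ∈ Ψ.source := by rw [hu.self_of_nhds, hs, mem_preimage, B.proj_ract]; exact hx
  -- Equivariance of `Ψ` makes `u` the quotient of the circle coordinates of `d` and `c`.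
  refine ((key d hd hds).mul ((key c hc hcs).inv (Circle.coe_ne_zero _))).congr_of_eventuallyEq ?_
  filter_upwards [hu, hc.continuousAt.preimage_mem_nhds (Ψ.open_source.mem_nhds hcs)] with r hr hr'
  have := Circle.coe_ne_zero (Ψ (c r)).2
  simp only [Pi.mul_apply, Pi.inv_apply]
  rw [hr, h2 _ hr']
  push_cast
  field_simp

theorem PrincipalU1Bundle.continuousWithinAt_ratio (B : PrincipalU1Bundle IM M IP P) {c d : ℝ → P}
    {u : ℝ → Circle} {S : Set ℝ} {s : ℝ} (hsS : s ∈ S) (hc : ContinuousWithinAt c S s)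
    (hd : ContinuousWithinAt d S s) (hu : ∀ r ∈ S, d r = B.ract (c r) (u r)) :
    ContinuousWithinAt u S s := by
  obtain ⟨U, hU, hx, Ψ, hs, -, -, -, h1, h2⟩ := B.locally_trivial (B.proj (c s))
  have hcs : c s ∈ Ψ.source := by rw [hs]; exact hx
  have hds : d s ∈ Ψ.source := by rw [hu s hsS, hs, mem_preimage, B.proj_ract]; exact hx
  have key : ∀ e : ℝ → P, ContinuousWithinAt e S s → e s ∈ Ψ.source →
      ContinuousWithinAt (fun r => (Ψ (e r)).2) S s := fun e he hes =>
    continuous_snd.continuousAt.comp_continuousWithinAt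
      ((Ψ.continuousAt hes).comp_continuousWithinAt he)
  have hev : ∀ r ∈ S, c r ∈ Ψ.source → u r = (Ψ (c r)).2⁻¹ * (Ψ (d r)).2 := by
    intro r hr hr'
    rw [hu r hr, h2 _ hr', inv_mul_cancel_left]
  refine ((key c hc hcs).inv.mul (key d hd hds)).congr_of_eventuallyEq ?_ (hev s hsS hcs)
  filter_upwards [self_mem_nhdsWithin, hc.preimage_mem_nhdsWithin (Ψ.open_source.mem_nhds hcs)]
    with r hr hr' using hev r hr hr'

/-! ### The connection form along curves. -/

variable [IsManifold IP ∞ P] {B : PrincipalU1Bundle IM M IP P} (Ξ : Connection B)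

/-- The value `Ξ(c'(s))` of the connection on the velocity of a curve. -/
def Connection.velocity (c : ℝ → P) (s : ℝ) : ℂ :=
  Ξ.form (c s) (mfderiv 𝓘(ℝ, ℝ) IP c s (1 : ℝ))

theorem Connection.velocity_congr {c d : ℝ → P} {s : ℝ} (h : c =ᶠ[𝓝 s] d) :
    Ξ.velocity c s = Ξ.velocity d s := by
  -- Tangent spaces at different points all unfold to `EP`, so the base point and the derivative can
  -- be replaced together.
  have gen : ∀ (p q : P) (f g : ℝ →L[ℝ] EP), p = q → f = g →
      Ξ.form p (f (1 : ℝ)) = Ξ.form q (g (1 : ℝ)) := by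
    rintro p _ f _ rfl rfl
    rfl
  exact gen _ _ _ _ h.self_of_nhds (h.mfderiv_eq (I := 𝓘(ℝ, ℝ)) (I' := IP))

theorem Connection.velocity_comp {c : ℝ → P} {g : ℝ → ℝ} {g' s : ℝ} (hg : HasDerivAt g g' s)
    (hc : MDifferentiableAt 𝓘(ℝ, ℝ) IP c (g s)) :
    Ξ.velocity (fun r => c (g r)) s = g' * Ξ.velocity c (g s) := by
  have e : mfderiv 𝓘(ℝ, ℝ) IP (fun r => c (g r)) s (1 : ℝ) =
      mfderiv 𝓘(ℝ, ℝ) IP c (g s) (mfderiv 𝓘(ℝ, ℝ) 𝓘(ℝ, ℝ) g s (1 : ℝ)) := by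
    rw [show (fun r => c (g r)) = c ∘ g from rfl,
      mfderiv_comp (I' := 𝓘(ℝ, ℝ)) s hc hg.differentiableAt.mdifferentiableAt]
    rfl
  have e2 : mfderiv 𝓘(ℝ, ℝ) 𝓘(ℝ, ℝ) g s (1 : ℝ) = g' • (1 : ℝ) := by
    have h : fderiv ℝ g s 1 = g' := by simp [hg.deriv]
    rw [mfderiv_eq_fderiv, smul_eq_mul, mul_one]
    exact h
  unfold Connection.velocity
  rw [e, e2]
  have e3 : mfderiv 𝓘(ℝ, ℝ) IP c (g s) (g' • (1 : ℝ)) = g' • mfderiv 𝓘(ℝ, ℝ) IP c (g s) (1 : ℝ) :=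
    (mfderiv 𝓘(ℝ, ℝ) IP c (g s)).map_smul g' (1 : ℝ)
  rw [e3]
  exact ((Ξ.form (c (g s))).map_smul g' _).trans (by simp)

theorem Connection.velocity_ract {c : ℝ → P} {s : ℝ} (hc : MDifferentiableAt 𝓘(ℝ, ℝ) IP c s)
    (u : Circle) : Ξ.velocity (fun r => B.ract (c r) u) s = Ξ.velocity c s := by
  unfold Connection.velocity
  rw [show (fun r => B.ract (c r) u) = (fun z => B.ract z u) ∘ c from rfl,
    mfderiv_comp (I' := IP) s ((B.contMDiff_ract_right u).mdifferentiable (by simp) _) hc]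
  exact Ξ.form_ract u _ _

theorem Connection.velocity_vertical (y : P) (θ : ℝ) :
    Ξ.velocity (fun r => B.ract y (Circle.exp r)) θ = Complex.I := by
  -- Moving the base point to `y · exp(iθ)` shifts the parameter to `0`, where `form_vertical`
  -- applies.
  have e : (fun r => B.ract y (Circle.exp r)) =
      fun r => (fun q => B.ract (B.ract y (Circle.exp θ)) (Circle.exp q)) (r - θ) := by
    funext r
    simp only [← B.ract_mul, ← Circle.exp_add, add_sub_cancel]
  rw [e, Ξ.velocity_comp (g' := 1) (by simpa using (hasDerivAt_id θ).sub_const θ)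
    ((B.contMDiff_rotate_right _).mdifferentiable (by simp) _), sub_self]
  rw [Complex.ofReal_one, one_mul]
  exact Ξ.form_vertical (B.ract y (Circle.exp θ))

/-- `Ξ` of the velocity of `c · exp(iθ)` is `Ξ(c') + i θ'`. -/
theorem Connection.velocity_rotate {c : ℝ → P} {θ : ℝ → ℝ} {θ' s : ℝ}
    (hc : MDifferentiableAt 𝓘(ℝ, ℝ) IP c s) (hθ : HasDerivAt θ θ' s) :
    Ξ.velocity (fun r => B.ract (c r) (Circle.exp (θ r))) s =
      Ξ.velocity c s + θ' * Complex.I := by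
  have hK : MDifferentiableAt (IP.prod 𝓘(ℝ, ℝ)) IP
      (fun q : P × ℝ => B.ract q.1 (Circle.exp q.2)) (c s, θ s) :=
    B.contMDiff_rotate.mdifferentiable (by simp) _
  have hθm := hθ.differentiableAt.mdifferentiableAt
  -- The derivative of the action splits into partials: the first is handled by invariance of `Ξ`,
  -- the second is vertical.
  have e : mfderiv 𝓘(ℝ, ℝ) IP (fun r => B.ract (c r) (Circle.exp (θ r))) s (1 : ℝ) =
      mfderiv IP IP (fun z => B.ract z (Circle.exp (θ s))) (c s)
        (mfderiv 𝓘(ℝ, ℝ) IP c s (1 : ℝ)) +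
      mfderiv 𝓘(ℝ, ℝ) IP (fun r => B.ract (c s) (Circle.exp r)) (θ s)
        (mfderiv 𝓘(ℝ, ℝ) 𝓘(ℝ, ℝ) θ s (1 : ℝ)) := by
    rw [show (fun r => B.ract (c r) (Circle.exp (θ r))) =
        (fun q : P × ℝ => B.ract q.1 (Circle.exp q.2)) ∘ fun r => (c r, θ r) from rfl,
      mfderiv_comp (I' := IP.prod 𝓘(ℝ, ℝ)) s hK (hc.prodMk hθm), hc.mfderiv_prod hθm]
    exact mfderiv_prod_eq_add_apply hK
  have e1 := Ξ.velocity_ract hc (Circle.exp (θ s))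
  have e2 := Ξ.velocity_comp hθ (c := fun r => B.ract (c s) (Circle.exp r))
    ((B.contMDiff_rotate_right _).mdifferentiable (by simp) _)
  rw [Ξ.velocity_vertical] at e2
  rw [← e2, ← e1]
  unfold Connection.velocity
  rw [e]
  rw [show (fun r => B.ract (c r) (Circle.exp (θ s))) =
      (fun z => B.ract z (Circle.exp (θ s))) ∘ c from rfl,
    mfderiv_comp (I' := IP) s ((B.contMDiff_ract_right _).mdifferentiable (by simp) _) hc,
    show (fun r => B.ract (c s) (Circle.exp (θ r))) =
      (fun r => B.ract (c s) (Circle.exp r)) ∘ θ from rfl,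
    mfderiv_comp (I' := 𝓘(ℝ, ℝ)) s ((B.contMDiff_rotate_right _).mdifferentiable (by simp) _) hθm]
  exact (Ξ.form (B.ract (c s) (Circle.exp (θ s)))).map_add _ _

/-- The ratio of two horizontal curves in the same fibres has vanishing derivative. -/
theorem Connection.hasDerivAt_ratio {c d : ℝ → P} {u : ℝ → Circle} {s : ℝ}
    (hc : MDifferentiableAt 𝓘(ℝ, ℝ) IP c s) (hd : MDifferentiableAt 𝓘(ℝ, ℝ) IP d s)
    (hu : ∀ᶠ r in 𝓝 s, d r = B.ract (c r) (u r)) (hcd : Ξ.velocity c s = Ξ.velocity d s) :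
    HasDerivAt (fun r => (u r : ℂ)) 0 s := by
  have hdiff := B.differentiableAt_ratio hc hd hu
  -- Dividing by `u s` gives the value `1` at `s`, away from the branch cut, so `arg` is a
  -- differentiable angle there.
  have hw : DifferentiableAt ℝ (fun r => (((u s)⁻¹ * u r : Circle) : ℂ)) s := by
    push_cast
    exact hdiff.const_mul _
  have hlog : DifferentiableAt ℝ (fun r => Complex.log (((u s)⁻¹ * u r : Circle) : ℂ)) s := by
    refine (hw.hasDerivAt.clog_real ?_).differentiableAt
    simp
  have hθ : DifferentiableAt ℝ (fun r => Complex.arg (((u s)⁻¹ * u r : Circle) : ℂ)) s := by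
    have := Complex.imCLM.differentiableAt.comp s hlog
    simpa [Function.comp_def, Complex.log_im] using this
  set θ : ℝ → ℝ := fun r => Complex.arg (((u s)⁻¹ * u r : Circle) : ℂ) with hθdef
  have hexp : ∀ r, u r = u s * Circle.exp (θ r) := fun r => by
    simp only [hθdef, Circle.exp_arg, mul_inv_cancel_left]
  have hv := Ξ.velocity_rotate (c := fun r => B.ract (c r) (u s))
    (((B.contMDiff_ract_right (u s)).mdifferentiable (by simp) _).comp s hc) hθ.hasDerivAt
  rw [Ξ.velocity_ract hc] at hv
  have hv2 : Ξ.velocity d s =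
      Ξ.velocity (fun r => B.ract (B.ract (c r) (u s)) (Circle.exp (θ r))) s := by
    refine Ξ.velocity_congr ?_
    filter_upwards [hu] with r hr
    rw [hr, ← B.ract_mul, ← hexp]
  rw [hv, hcd] at hv2
  -- Now `Ξ(d') = Ξ(d') + iθ'`.
  have h0 : deriv θ s = 0 := by simpa using hv2
  have h1 : HasDerivAt θ 0 s := h0 ▸ hθ.hasDerivAt
  have h2 : (fun r => (u r : ℂ)) = fun r => (u s : ℂ) * Complex.exp (θ r * Complex.I) := by
    funext r
    rw [hexp r]
    simp [Circle.coe_exp]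
  rw [h2]
  simpa using ((h1.ofReal_comp.mul_const Complex.I).cexp.const_mul (u s : ℂ))

/-! ### Piecewise `C¹` curves. -/

theorem PiecewiseC1.continuousOn {γ : ℝ → M} (h : PiecewiseC1 IM γ) :
    ContinuousOn γ (Icc 0 1) := by
  obtain ⟨n, a, h0, h1, ha, hγ⟩ := h
  have key : ∀ k ≤ n, ContinuousOn γ (Icc (a 0) (a k)) := by
    intro k
    induction k with
    | zero => intro _; rw [Icc_self]; exact continuousOn_singleton _ _
    | succ k ih =>
      intro hk
      rw [← Icc_union_Icc_eq_Icc (ha (Nat.zero_le k)) (ha (Nat.le_succ k))]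
      exact (ih (by omega)).union_of_isClosed (hγ k (by omega)).continuousOn isClosed_Icc
        isClosed_Icc
  rw [← h0, ← h1]
  exact key n le_rfl

theorem PiecewiseC1.exists_countable_mdifferentiableAt {γ : ℝ → M} (h : PiecewiseC1 IM γ) :
    ∃ S : Set ℝ, S.Countable ∧
      ∀ s ∈ Ioo (0 : ℝ) 1 \ S, MDifferentiableAt 𝓘(ℝ, ℝ) IM γ s := by
  obtain ⟨n, a, h0, h1, ha, hγ⟩ := h
  -- Terms of `a` beyond `n` are excluded too; countability is all that the later integration needs.
  refine ⟨range a, countable_range a, fun s hs => ?_⟩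
  have key : ∀ k, a 0 < s → s < a k → ∃ i < k, s ∈ Ioo (a i) (a (i + 1)) := by
    intro k hs0
    induction k with
    | zero => intro h; exact absurd h (not_lt.2 hs0.le)
    | succ k ih =>
      intro hk
      rcases lt_trichotomy s (a k) with h | h | h
      · obtain ⟨i, hi, hi'⟩ := ih h
        exact ⟨i, by omega, hi'⟩
      · exact absurd ⟨k, h.symm⟩ hs.2
      · exact ⟨k, by omega, h, hk⟩
  obtain ⟨i, hi, hsi⟩ := key n (h0 ▸ hs.1.1) (h1 ▸ hs.1.2)
  exact ((hγ i hi s (Ioo_subset_Icc_self hsi)).contMDiffAt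
    (Icc_mem_nhds hsi.1 hsi.2)).mdifferentiableAt (by simp)

theorem ContMDiffOn.piecewiseC1 {γ : ℝ → M} (h : ContMDiffOn 𝓘(ℝ, ℝ) IM 1 γ (Icc 0 1)) :
    PiecewiseC1 IM γ := by
  refine ⟨1, fun i => i, by simp, by simp, Nat.mono_cast, fun i hi => ?_⟩
  obtain rfl : i = 0 := by omega
  simpa using h

/-! ### Uniqueness of horizontal lifts and of the holonomy. -/

variable {Ξ}

/-- Horizontal lifts are determined by their starting point. -/
theorem Connection.IsHorizontalLift.endpoint_unique {γ : ℝ → M} {y : P} {c d : ℝ → P}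
    (hc : Ξ.IsHorizontalLift γ y c) (hd : Ξ.IsHorizontalLift γ y d) : d 1 = c 1 := by
  have hex : ∀ r, ∃ u : Circle, r ∈ Icc (0 : ℝ) 1 → d r = B.ract (c r) u := by
    intro r
    by_cases hr : r ∈ Icc (0 : ℝ) 1
    · obtain ⟨u, hu⟩ := B.exists_ract_eq ((hc.proj_eq r hr).trans (hd.proj_eq r hr).symm)
      exact ⟨u, fun _ => hu⟩
    · exact ⟨1, fun h => absurd h hr⟩
  choose u hu using hex
  obtain ⟨S, hS, hcS⟩ := hc.piecewiseC1.exists_countable_mdifferentiableAt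
  obtain ⟨T, hT, hdT⟩ := hd.piecewiseC1.exists_countable_mdifferentiableAt
  have hcont : ContinuousOn (fun r => (u r : ℂ)) (Icc 0 1) := fun s hs =>
    continuous_subtype_val.continuousAt.comp_continuousWithinAt
      (B.continuousWithinAt_ratio hs (hc.piecewiseC1.continuousOn s hs)
        (hd.piecewiseC1.continuousOn s hs) hu)
  have hder : ∀ s ∈ Ioo (0 : ℝ) 1 \ (S ∪ T), HasDerivAt (fun r => (u r : ℂ)) 0 s := by
    rintro s ⟨hs, hst⟩
    have h1 := hcS s ⟨hs, fun h => hst (Or.inl h)⟩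
    have h2 := hdT s ⟨hs, fun h => hst (Or.inr h)⟩
    refine Ξ.hasDerivAt_ratio h1 h2 ?_ ((hc.horizontal s hs h1).trans (hd.horizontal s hs h2).symm)
    filter_upwards [Icc_mem_nhds hs.1 hs.2] with r hr using hu r hr
  -- The ratio is continuous on `[0,1]` with zero derivative off a countable set, hence constant;
  -- breakpoints need no separate treatment.
  have hint := MeasureTheory.integral_eq_of_hasDerivAt_off_countable_of_le
    (fun r => (u r : ℂ)) (fun _ => 0) zero_le_one (hS.union hT) hcont hder (by simp)
  have h0 : u 0 = 1 := by
    apply B.ract_injective (c 0)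
    rw [← hu 0 (by simp), B.ract_one, hc.start, hd.start]
  have h1 : u 1 = 1 := by
    rw [intervalIntegral.integral_zero, h0] at hint
    exact Circle.ext (sub_eq_zero.1 hint.symm)
  rw [hu 1 (by simp), h1, B.ract_one]

theorem Connection.IsHorizontalLift.ract {γ : ℝ → M} {y : P} {c : ℝ → P}
    (hc : Ξ.IsHorizontalLift γ y c) (hC : ∀ s ∈ Ioo (0 : ℝ) 1, MDifferentiableAt 𝓘(ℝ, ℝ) IP c s)
    (u : Circle) : Ξ.IsHorizontalLift γ (B.ract y u) (fun s => B.ract (c s) u) where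
  piecewiseC1 := by
    obtain ⟨n, a, h0, h1, ha, h⟩ := hc.piecewiseC1
    exact ⟨n, a, h0, h1, ha, fun i hi =>
      ((B.contMDiff_ract_right u).of_le (by simp)).comp_contMDiffOn (h i hi)⟩
  proj_eq s hs := by rw [B.proj_ract, hc.proj_eq s hs]
  start := by rw [hc.start]
  horizontal s hs _ := (Ξ.velocity_ract (hC s hs) u).trans (hc.horizontal s hs (hC s hs))

theorem Connection.IsHolonomy.unique {K : Type*} [Group K] [MulAction K P] {g : K} {γ : ℝ → M} {u v : Circle}
    (hu : Ξ.IsHolonomy g γ u) (hv : Ξ.IsHolonomy g γ v) : u = v := by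
  obtain ⟨y, hy⟩ := B.proj_surjective (γ 0)
  obtain ⟨⟨c, hc⟩, h⟩ := hu y hy
  exact B.ract_injective _ ((h c hc).symm.trans ((hv y hy).2 c hc))

theorem Connection.IsHolonomy.hol_eq {K : Type*} [Group K] [MulAction K P] {g : K} {γ : ℝ → M} {u : Circle}
    (hu : Ξ.IsHolonomy g γ u) : Ξ.hol g γ = u := by
  have h : ∃ u, Ξ.IsHolonomy g γ u := ⟨u, hu⟩
  rw [Connection.hol, dif_pos h]
  exact h.choose_spec.unique hu

/-- The holonomy is read off from a single differentiable horizontal lift. -/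
theorem Connection.IsHorizontalLift.isHolonomy {K : Type*} [Group K] [MulAction K M]
    [MulAction K P] (hB : IsEquivariant K B) {g : K} {γ : ℝ → M} {y : P} {c : ℝ → P} {u : Circle}
    (hc : Ξ.IsHorizontalLift γ y c) (hC : ∀ s ∈ Ioo (0 : ℝ) 1, MDifferentiableAt 𝓘(ℝ, ℝ) IP c s)
    (h1 : c 1 = B.ract (g • y) u) : Ξ.IsHolonomy g γ u := by
  intro z hz
  have hy : B.proj y = γ 0 := by rw [← hc.start]; exact hc.proj_eq 0 (by simp)
  obtain ⟨v, rfl⟩ := B.exists_ract_eq (hy.trans hz.symm)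
  have hl := hc.ract hC v
  refine ⟨⟨_, hl⟩, fun d hd => ?_⟩
  -- Commutativity of `U(1)` swaps `u` with the change `v` of fibre point.
  rw [hl.endpoint_unique hd, h1, hB.smul_ract, ← B.ract_mul, ← B.ract_mul, mul_comm]

/-! ### Construction of horizontal lifts. -/

/-- The velocity is the composite of `s ↦ (s, 1)`, the tangent map of `c`, and `Ξ` as a function on
the tangent bundle. Continuity is what makes its primitive `C¹`. -/
theorem Connection.continuousOn_velocity (Ξ : Connection B) {c : ℝ → P} {U : Set ℝ} (hU : IsOpen U)
    (hc : ContMDiffOn 𝓘(ℝ, ℝ) IP 1 c U) : ContinuousOn (Ξ.velocity c) U := by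
  have h1 := hc.continuousOn_tangentMapWithin le_rfl hU.uniqueMDiffOn
  have h2 : Continuous (fun s : ℝ => (⟨s, (1 : ℝ)⟩ : TangentBundle 𝓘(ℝ, ℝ) ℝ)) :=
    (tangentBundleModelSpaceHomeomorph 𝓘(ℝ, ℝ)).symm.continuous.comp
      (continuous_id.prodMk continuous_const)
  have h3 := (Ξ.contMDiff_form.continuous.comp_continuousOn h1).comp h2.continuousOn
    (s := U) (fun s hs => hs)
  refine h3.congr fun s hs => ?_
  simp only [Function.comp_apply, tangentMapWithin, mfderivWithin_of_isOpen hU hs]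
  rfl

/-- Every `C¹` curve becomes horizontal after a rotation. -/
theorem Connection.exists_horizontal_rotation (Ξ : Connection B) {c : ℝ → P} {a b t₀ : ℝ}
    (ht₀ : t₀ ∈ Ioo a b) (hc : ContMDiffOn 𝓘(ℝ, ℝ) IP 1 c (Ioo a b)) :
    ∃ θ : ℝ → ℝ, θ t₀ = 0 ∧ (∀ τ ∈ Ioo a b, HasDerivAt θ (-(Ξ.velocity c τ).im) τ) ∧
      ContMDiffOn 𝓘(ℝ, ℝ) IP 1 (fun τ => B.ract (c τ) (Circle.exp (θ τ))) (Ioo a b) ∧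
      ∀ τ ∈ Ioo a b, Ξ.velocity (fun τ => B.ract (c τ) (Circle.exp (θ τ))) τ = 0 := by
  have hv : ContinuousOn (fun τ => -(Ξ.velocity c τ).im) (Ioo a b) :=
    (Complex.continuous_im.comp_continuousOn (Ξ.continuousOn_velocity isOpen_Ioo hc)).neg
  have hθ : ∀ τ ∈ Ioo a b, HasDerivAt (fun τ => ∫ r in t₀..τ, -(Ξ.velocity c r).im)
      (-(Ξ.velocity c τ).im) τ := fun τ hτ =>
    intervalIntegral.integral_hasDerivAt_right
      ((hv.mono (ordConnected_Ioo.uIcc_subset ht₀ hτ)).intervalIntegrable)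
      (hv.stronglyMeasurableAtFilter isOpen_Ioo τ hτ) (hv.continuousAt (isOpen_Ioo.mem_nhds hτ))
  refine ⟨fun τ => ∫ r in t₀..τ, -(Ξ.velocity c r).im, by simp, hθ, ?_, fun τ hτ => ?_⟩
  · have hθ1 : ContDiffOn ℝ 1 (fun τ => ∫ r in t₀..τ, -(Ξ.velocity c r).im) (Ioo a b) := by
      rw [contDiffOn_one_iff_derivWithin isOpen_Ioo.uniqueDiffOn]
      refine ⟨fun τ hτ => (hθ τ hτ).differentiableAt.differentiableWithinAt, hv.congr ?_⟩
      intro τ hτ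
      rw [derivWithin_of_isOpen isOpen_Ioo hτ, (hθ τ hτ).deriv]
    exact (B.contMDiff_rotate.of_le (by simp)).comp_contMDiffOn (hc.prodMk hθ1.contMDiffOn)
  · have hcτ := (hc.contMDiffAt (isOpen_Ioo.mem_nhds hτ)).mdifferentiableAt one_ne_zero
    rw [Ξ.velocity_rotate hcτ (hθ τ hτ)]
    apply Complex.ext
    · have : (Ξ.velocity c τ).re = 0 := Ξ.re_form _ _
      simpa using this
    · simp

/-- An affine reparametrization of a horizontal `C¹` curve is a horizontal lift. -/
theorem Connection.isHorizontalLift_reparam {C : ℝ → P} {γ : ℝ → M} {a b t₀ t : ℝ}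
    (ht₀ : t₀ ∈ Ioo a b) (ht : t ∈ Ioo a b) (hC : ContMDiffOn 𝓘(ℝ, ℝ) IP 1 C (Ioo a b))
    (hv : ∀ τ ∈ Ioo a b, Ξ.velocity C τ = 0)
    (hγ : ∀ τ ∈ Ioo a b, B.proj (C τ) = γ τ) :
    Ξ.IsHorizontalLift (fun s => γ (t₀ + s * (t - t₀))) (C t₀) (fun s => C (t₀ + s * (t - t₀))) ∧
      ∀ s ∈ Ioo (0 : ℝ) 1, MDifferentiableAt 𝓘(ℝ, ℝ) IP (fun s => C (t₀ + s * (t - t₀))) s := by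
  have hmaps : ∀ s ∈ Icc (0 : ℝ) 1, t₀ + s * (t - t₀) ∈ Ioo a b := fun s hs => by
    have := (convex_Ioo a b) ht₀ ht (sub_nonneg.2 hs.2) hs.1 (by ring)
    convert this using 1
    simp only [smul_eq_mul]
    ring
  have hd : ∀ s ∈ Ioo (0 : ℝ) 1, MDifferentiableAt 𝓘(ℝ, ℝ) IP C (t₀ + s * (t - t₀)) :=
    fun s hs => (hC.contMDiffAt (isOpen_Ioo.mem_nhds
      (hmaps s (Ioo_subset_Icc_self hs)))).mdifferentiableAt one_ne_zero
  have haff : ContDiff ℝ 1 (fun s : ℝ => t₀ + s * (t - t₀)) := by fun_prop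
  have hder : ∀ s : ℝ, HasDerivAt (fun s : ℝ => t₀ + s * (t - t₀)) (t - t₀) s := fun s => by
    simpa using ((hasDerivAt_id s).mul_const (t - t₀)).const_add t₀
  refine ⟨⟨ContMDiffOn.piecewiseC1 (hC.comp haff.contMDiff.contMDiffOn hmaps),
    fun s hs => hγ _ (hmaps s hs), by simp, fun s hs _ => ?_⟩,
    fun s hs => (hd s hs).comp s (hder s).differentiableAt.mdifferentiableAt⟩
  -- The chain rule only scales by `t - t₀`; the constant case `t = t₀` is included.
  refine (Ξ.velocity_comp (hder s) (hd s hs)).trans ?_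
  rw [hv _ (hmaps s (Ioo_subset_Icc_self hs)), mul_zero]

/-! ### The momentum and the derivative of the holonomy. -/

/-- `2πi μ_X` is minus the value of the connection on the velocity of an orbit curve. -/
theorem Connection.momentum_eq_velocity (Ξ : Connection B) [MulAction G M] [MulAction G P]
    [ContMDiffSMul IG IP ∞ G P] (hB : IsEquivariant G B) {φ : ℝ → G} {t₀ : ℝ}
    (hφ : MDifferentiableAt 𝓘(ℝ, ℝ) IG φ t₀) (X : GroupLieAlgebra IG G)
    (hX : (⟨φ t₀, mfderiv 𝓘(ℝ, ℝ) IG φ t₀ (1 : ℝ)⟩ : TangentBundle IG G) = ⟨1, X⟩) (y : P) :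
    2 * Real.pi * Complex.I * (Ξ.momentum X (B.proj y) : ℂ) =
      -Ξ.velocity (fun t => φ t • y) t₀ := by
  have ho := (contMDiff_orbit (IG := IG) (IP := IP) (G := G) y).mdifferentiable (by simp)
  -- Since `φ t₀ = 1` is not definitional, the velocity and `X` are compared in the total space of
  -- the tangent bundle.
  have gen : ∀ v : TangentBundle IG G, v = ⟨1, X⟩ →
      Ξ.form (v.proj • y) (mfderiv IG IP (fun g : G => g • y) v.proj v.snd) =
        -Ξ.form ((1 : G) • y) (fundamentalField X y) := by
    rintro _ rfl
    have h : fundamentalField X y = -mfderiv IG IP (fun g : G => g • y) 1 X :=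
      (mfderiv IG IP (fun g : G => g • y) 1).map_neg X
    rw [h]
    exact (neg_eq_iff_eq_neg.2 ((Ξ.form ((1 : G) • y)).map_neg _)).symm.trans rfl
  have hvel : Ξ.velocity (fun t => φ t • y) t₀ =
      -Ξ.form ((1 : G) • y) (fundamentalField X y) := by
    rw [← gen _ hX, Connection.velocity,
      show (fun t => φ t • y) = (fun g : G => g • y) ∘ φ from rfl,
      mfderiv_comp (I' := IG) t₀ (ho _) hφ]
    rfl
  rw [hvel, neg_neg, Ξ.momentum_proj hB]
  have hpi : (Real.pi : ℂ) ≠ 0 := by exact_mod_cast Real.pi_ne_zero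
  generalize Ξ.form ((1 : G) • y) (fundamentalField X y) = w
  field_simp
  linear_combination (-w) * Complex.I_sq

end EquivHol

end

theorem mainTheorem5
    {EG : Type*} [NormedAddCommGroup EG] [NormedSpace ℝ EG] [FiniteDimensional ℝ EG]
    {HG : Type*} [TopologicalSpace HG] (IG : ModelWithCorners ℝ EG HG) [IG.Boundaryless]
    {G : Type*} [TopologicalSpace G] [ChartedSpace HG G] [Group G] [LieGroup IG ∞ G]
    {EM : Type*} [NormedAddCommGroup EM] [NormedSpace ℝ EM] [FiniteDimensional ℝ EM]
    {HM : Type*} [TopologicalSpace HM] (IM : ModelWithCorners ℝ EM HM) [IM.Boundaryless]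
    {M : Type*} [TopologicalSpace M] [ChartedSpace HM M] [IsManifold IM ∞ M]
    {EP : Type*} [NormedAddCommGroup EP] [NormedSpace ℝ EP] [FiniteDimensional ℝ EP]
    {HP : Type*} [TopologicalSpace HP] (IP : ModelWithCorners ℝ EP HP) [IP.Boundaryless]
    {P : Type*} [TopologicalSpace P] [ChartedSpace HP P] [IsManifold IP ∞ P]
    [MulAction G M] [ContMDiffSMul IG IM ∞ G M] [MulAction G P] [ContMDiffSMul IG IP ∞ G P]
    (B : EquivHol.PrincipalU1Bundle IM M IP P) (hB : EquivHol.IsEquivariant G B)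
    (Ξ : EquivHol.Connection B) (hΞ : Ξ.IsInvariant G)
    (t₀ ε : ℝ) (hε : 0 < ε) (φ : ℝ → G)
    (hφ : ContMDiffOn 𝓘(ℝ, ℝ) IG 1 φ (Ioo (t₀ - ε) (t₀ + ε))) (hφ₀ : φ t₀ = 1)
    (X : GroupLieAlgebra IG G)
    (hX : (⟨φ t₀, mfderiv 𝓘(ℝ, ℝ) IG φ t₀ (1 : ℝ)⟩ : TangentBundle IG G) = ⟨1, X⟩)
    (x : M) :
    (∀ t ∈ Ioo (t₀ - ε) (t₀ + ε),
      EquivHol.orbitPath φ t₀ x t ∈ EquivHol.pathSpace IM (φ t) x ∧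
      Ξ.IsHolonomy (φ t) (EquivHol.orbitPath φ t₀ x t)
        (Ξ.hol (φ t) (EquivHol.orbitPath φ t₀ x t))) ∧
    HasDerivAt (fun t : ℝ => (Ξ.hol (φ t) (EquivHol.orbitPath φ t₀ x t) : ℂ))
      (2 * Real.pi * Complex.I * (Ξ.momentum X x : ℂ)) t₀ := by
  obtain ⟨y, rfl⟩ := B.proj_surjective x
  have ht₀ : t₀ ∈ Ioo (t₀ - ε) (t₀ + ε) := ⟨by linarith, by linarith⟩
  have hD : ContMDiffOn 𝓘(ℝ, ℝ) IP 1 (fun t => φ t • y) (Ioo (t₀ - ε) (t₀ + ε)) :=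
    ((EquivHol.contMDiff_orbit (IG := IG) (IP := IP) (G := G) y).of_le (by simp)).comp_contMDiffOn
      hφ
  obtain ⟨θ, hθ0, hθ, hC, hv⟩ := Ξ.exists_horizontal_rotation ht₀ hD
  have hproj : ∀ t, B.proj (B.ract (φ t • y) (Circle.exp (θ t))) = φ t • B.proj y := fun t => by
    rw [B.proj_ract, hB.proj_smul]
  have hlift := fun t (ht : t ∈ Ioo (t₀ - ε) (t₀ + ε)) =>
    EquivHol.Connection.isHorizontalLift_reparam (γ := fun t => φ t • B.proj y) ht₀ ht hC hv
      fun τ _ => hproj τ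
  have hstart : B.ract (φ t₀ • y) (Circle.exp (θ t₀)) = y := by
    rw [hφ₀, hθ0, one_smul, Circle.exp_zero, B.ract_one]
  have hhol : ∀ t ∈ Ioo (t₀ - ε) (t₀ + ε), Ξ.IsHolonomy (φ t)
      (EquivHol.orbitPath φ t₀ (B.proj y) t) (Circle.exp (θ t)) := fun t ht => by
    obtain ⟨h1, h2⟩ := hlift t ht
    rw [hstart] at h1
    exact h1.isHolonomy hB h2 (by simp)
  refine ⟨fun t ht => ⟨⟨?_, ?_, ?_⟩, ?_⟩, ?_⟩
  -- The orbit path is the projection of its piecewise `C¹` lift.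
  · obtain ⟨h1, -⟩ := hlift t ht
    obtain ⟨n, a, h0, h1', ha, h⟩ := h1.piecewiseC1
    refine ⟨n, a, h0, h1', ha, fun i hi => ?_⟩
    refine ((B.contMDiff_proj.of_le (by simp)).comp_contMDiffOn (h i hi)).congr fun s _ => ?_
    exact (hproj _).symm
  · simp [EquivHol.orbitPath, hφ₀]
  · simp [EquivHol.orbitPath]
  · rw [(hhol t ht).hol_eq]
    exact hhol t ht
  · have hφd : MDifferentiableAt 𝓘(ℝ, ℝ) IG φ t₀ :=
      (hφ.contMDiffAt (isOpen_Ioo.mem_nhds ht₀)).mdifferentiableAt one_ne_zero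
    have hre : (Ξ.velocity (fun t => φ t • y) t₀).re = 0 := Ξ.re_form _ _
    -- The factor `exp(iθ(t₀)) = 1` gives the value the shape of the derivative of `exp(iθ)`.
    have hval : 2 * Real.pi * Complex.I * (Ξ.momentum X (B.proj y) : ℂ) =
        Complex.exp (θ t₀ * Complex.I) *
          (((-(Ξ.velocity (fun t => φ t • y) t₀).im : ℝ) : ℂ) * Complex.I) := by
      rw [Ξ.momentum_eq_velocity hB hφd X hX, hθ0]
      apply Complex.ext <;> simp [hre]
    rw [hval]
    refine ((hθ t₀ ht₀).ofReal_comp.mul_const Complex.I).cexp.congr_of_eventuallyEq ?_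
    filter_upwards [isOpen_Ioo.mem_nhds ht₀] with t ht
    rw [(hhol t ht).hol_eq, Circle.coe_exp]
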